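/- Let $0<\alpha<1$ and let $N\ge 2$ be an integer. For real $a_1,a_2$ let $A=(A_{km})$ be the $N\times N$ symmetric circulant matrix with indices modulo $N$ whose entry at $(k,k)$ is $a_1$ and whose entries at $(k,k+1)$ and $(k,k-1)$ are $a_0=a_2$ (for $N=2$ the two contributions add up, so that $A_{12}=A_{21}=2a_2$). Consider the linear fractional-order coupled map lattice in $\mathbb{R}^N$ $$X_{t+1}=X_0+\sum_{j=0}^{t}\frac{\Gamma(t-j+\alpha)}{\Gamma(\alpha)\,\Gamma(t-j+1)}\,(A-I)X_j,\qquad t=0,1,2,\dots$$ Its stable region is the set of all $(a_2,a_1)\in\mathbb{R}^2$ for which the zero solution is asymptotically stable, i.e. for every $\varepsilon>0$ there is $\delta>0$ such that every solution with $\|X_0\|<\delta$ satisfies $\|X_t\|<\varepsilon$ for all $t$, and there is $\delta>0$ such that every solution with $\|X_0\|<\delta$ satisfies $X_t\to 0$ as $t\to\infty$. Then the stable region is exactly the open region bounded by a convex quadrilateral (that is, it is the interior of the convex hull of the four vertices, and its boundary is the union of the four sides). The successive vertices in the $a_2a_1$-plane are, if $N$ is even, $$Q_1=(0,1),\quad Q_2=\left(-2^{\alpha-2},\,2^{\alpha-1}+1-2^{\alpha}\right),\quad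 Q_3=(0,1-2^{\alpha}),\quad Q_4=\left(2^{\alpha-2},\,1-2^{\alpha-1}\right),$$ and, if $N$ is odd, $Q_1=(0,1)$, $$Q_2'=\left(-\frac{2^{\alpha-1}}{1+\cos(\pi/N)},\,\frac{2^{\alpha}}{1+\cos(\pi/N)}+1-2^{\alpha}\right),\quad Q_3=(0,1-2^{\alpha}),\quad Q_4'=\left(\frac{2^{\alpha-1}}{1+\cos(\pi/N)},\,-\frac{2^{\alpha}}{1+\cos(\pi/N)}+1\right).$$ -/

import Mathlib

open scoped Matrix

noncomputable section

namespace FracCML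

/-- The memory kernel `Γ(n + α) / (Γ(α) Γ(n + 1))` of the fractional sum of order `α`. -/
def kernel (α : ℝ) (n : ℕ) : ℝ :=
  Real.Gamma (n + α) / (Real.Gamma α * Real.Gamma (n + 1))

/-- `X` is a solution of the linear fractional-order system
`X_{t+1} = X_0 + ∑_{j=0}^{t} Γ(t-j+α) / (Γ(α) Γ(t-j+1)) (A - I) X_j`, for `t = 0, 1, 2, …`. -/
def IsSolution {ι : Type*} [Fintype ι] [DecidableEq ι] (α : ℝ) (A : Matrix ι ι ℝ)
    (X : ℕ → ι → ℝ) : Prop :=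
  ∀ t : ℕ, X (t + 1) =
    X 0 + ∑ j ∈ Finset.range (t + 1), kernel α (t - j) • ((A - 1) *ᵥ X j)

/-- The zero solution is (Lyapunov) stable. All norms on `ι → ℝ` give the same notion. -/
def ZeroStable {ι : Type*} [Fintype ι] [DecidableEq ι] (α : ℝ) (A : Matrix ι ι ℝ) : Prop :=
  ∀ ε > 0, ∃ δ > 0, ∀ X : ℕ → ι → ℝ, IsSolution α A X → ‖X 0‖ < δ → ∀ t, ‖X t‖ < ε

/-- The zero solution is (locally) attractive. -/
def ZeroAttractive {ι : Type*} [Fintype ι] [DecidableEq ι] (α : ℝ) (A : Matrix ι ι ℝ) : Prop :=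
  ∃ δ > 0, ∀ X : ℕ → ι → ℝ, IsSolution α A X → ‖X 0‖ < δ →
    Filter.Tendsto X Filter.atTop (nhds 0)

/-- The zero solution is asymptotically stable: stable and attractive. -/
def ZeroAsymptoticallyStable {ι : Type*} [Fintype ι] [DecidableEq ι] (α : ℝ)
    (A : Matrix ι ι ℝ) : Prop :=
  ZeroStable α A ∧ ZeroAttractive α A

/-- The circulant connectivity matrix of the ring of `N` lattice points (indices modulo `N`):
`a₁` on the diagonal, `a₂` at `(k, k + 1)` and `a₀` at `(k, k - 1)`. Contributions that fall on
the same entry are added, so the off-diagonal entries are `a₀ + a₂` for `N = 2`. -/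
def couplingMatrix (N : ℕ) (a₀ a₁ a₂ : ℝ) : Matrix (ZMod N) (ZMod N) ℝ :=
  Matrix.of fun k m =>
    (if m = k then a₁ else 0) + (if m = k + 1 then a₂ else 0) + (if m = k - 1 then a₀ else 0)

/-- The stable region of the symmetric system `a₀ = a₂`: the set of points `(a₂, a₁)` for which
the zero solution is asymptotically stable. -/
def symmetricStableRegion (α : ℝ) (N : ℕ) [NeZero N] : Set (ℝ × ℝ) :=
  {p | ZeroAsymptoticallyStable α (couplingMatrix N p.1 p.2 p.1)}

/-- `S` is the open region bounded by the convex quadrilateral with successive vertices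
`P₁, P₂, P₃, P₄`: it is the interior of their convex hull, and its boundary consists of the four
sides. -/
def IsRegionBoundedByQuadrilateral (S : Set (ℝ × ℝ)) (P₁ P₂ P₃ P₄ : ℝ × ℝ) : Prop :=
  S = interior (convexHull ℝ {P₁, P₂, P₃, P₄}) ∧
  frontier S = segment ℝ P₁ P₂ ∪ segment ℝ P₂ P₃ ∪ segment ℝ P₃ P₄ ∪ segment ℝ P₄ P₁

end FracCML

end

/-!
The proof reduces the coupled system to scalar ones, decides the scalar case, and then reads the
region off the spectrum of the coupling matrix.

**Scalar systems.** Let `u` be the solution of the scalar system with coefficient `μ = -ν` and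
`u₀ = 1`, and let `U` be its generating function. Since the kernel is the coefficient sequence of
`(1 - z) ^ (-α)`, the system says `((1 - z) ^ α + ν z) U = (1 - z) ^ (α - 1)`
(`genFun_identity`).

For `0 < ν < 2 ^ α` one has `u → 0`. The coefficients of `-(1 - z) ^ α` after the constant one are
`α` times the moments of the beta distribution with parameters `1 - α`, `1 + α`. Hence, for
`ν = ρ + α ∫ ρ / (v + ρ)`, there is a factorization
`(1 - z) ^ α + ν z = (1 + ρ z) (1 - C(z))` in which `C` has the explicit nonnegative coefficients
`α ∫ v ^ n / (v + ρ)`, with sum at most `1 - ν / (1 + ρ) < 1` (`one_add_mul_one_sub_quotientSeries`,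
`sum_coeff_quotientSeries_le`). As a function of `ρ` the right-hand side for `ν` is continuous, is
`0` at `ρ = 0` and `2 ^ α` at `ρ = 1` (`rootValue_one`), so each such `ν` belongs to some `ρ < 1`.
Then `1 / (1 + ρ z)` and `1 / (1 - C)` have absolutely summable coefficients, those of
`(1 - z) ^ (α - 1)` tend to `0`, and so do those of the product `U`. This takes the place of a
Tauberian argument on the unit circle.

For `ν ≤ 0` the solution stays above `1`. For `ν ≥ 2 ^ α` the function `(1 + s) ^ α - ν s` either
has a zero in `(0, 1)`, which contradicts the identity if `U(-s)` converges, or vanishes to first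
order at `s = 1`, whereas `(1 - s) U(-s) → 0` for a null sequence by Abel's theorem
(`not_tendsto_fundamentalSolution`).

**The lattice.** The discrete Fourier transform turns the system into scalar systems with
`μ + 1 = a₁ + 2 a₂ cos (2πj/N)`, so the zero solution is asymptotically stable exactly if all these
numbers lie in `(1 - 2 ^ α, 1)` (`zeroAsymptoticallyStable_iff`). The values `cos (2πj/N)` have
greatest element `1` and least element `-c`, with `c = 1` for even `N` and `c = cos (π/N)` for odd
`N`. So only `a₁ + 2 a₂` and `a₁ - 2 c a₂` matter, and the stable region is the preimage of an open
square under a linear isomorphism of the plane.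
-/

/-! ### Power series and null sequences -/

namespace FracCML

open PowerSeries Filter Topology

/-- The formal power series of `(1 - z) ^ (-β)`. -/
noncomputable def fracSeries (β : ℝ) : PowerSeries ℝ :=
  PowerSeries.mk fun n => Ring.multichoose β n

theorem fracSeries_eq_rescale (β : ℝ) :
    fracSeries β = rescale (-1 : ℝ) (binomialSeries ℝ (-β)) := by
  ext n
  rw [coeff_rescale, binomialSeries_coeff, Ring.choose_neg', fracSeries, coeff_mk]
  rw [← Int.cast_negOnePow_natCast]
  simp only [Units.smul_def, zsmul_eq_mul, smul_eq_mul, mul_one, ← mul_assoc, ← Int.cast_mul]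
  simp [← Units.val_mul]

theorem fracSeries_add (β γ : ℝ) : fracSeries (β + γ) = fracSeries β * fracSeries γ := by
  simp only [fracSeries_eq_rescale, neg_add, binomialSeries_add, map_mul]

theorem fracSeries_zero : fracSeries 0 = 1 := by
  simp [fracSeries_eq_rescale]

theorem coeff_fracSeries_one (n : ℕ) : coeff n (fracSeries 1) = 1 := by
  simp [fracSeries, Ring.multichoose_one]

theorem coeff_zero_fracSeries (β : ℝ) : coeff 0 (fracSeries β) = 1 := by
  simp [fracSeries]

theorem coeff_fracSeries {β : ℝ} (hβ : ∀ m : ℕ, β ≠ -m) (n : ℕ) :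
    coeff n (fracSeries β) = kernel β n := by
  have hΓ : Real.Gamma β ≠ 0 := Real.Gamma_ne_zero hβ
  have key : Real.Gamma (n + β) = (ascPochhammer ℝ n).eval β * Real.Gamma β := by
    induction n with
    | zero => simp
    | succ n ih =>
      have h : (n : ℝ) + β ≠ 0 := fun h => hβ n (by linarith)
      rw [Nat.cast_succ, add_right_comm, Real.Gamma_add_one h, ih, ascPochhammer_succ_eval]
      ring
  have hf := Ring.factorial_nsmul_multichoose_eq_ascPochhammer β n
  rw [Polynomial.ascPochhammer_smeval_eq_eval, nsmul_eq_mul] at hf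
  have hn : (n.factorial : ℝ) ≠ 0 := by positivity
  rw [fracSeries, coeff_mk, kernel, key, ← hf, Real.Gamma_nat_eq_factorial]
  field_simp

theorem hasSum_fracSeries (β : ℝ) {z : ℝ} (hz : |z| < 1) :
    HasSum (fun n => coeff n (fracSeries β) * z ^ n) ((1 - z) ^ (-β)) := by
  have h := (Real.one_div_one_sub_rpow_hasFPowerSeriesOnBall_zero β).hasSum
    (y := z) (by simpa [enorm_eq_nnnorm, ← NNReal.coe_lt_coe] using hz)
  rw [zero_add, one_div, ← Real.rpow_neg (by linarith [(abs_lt.1 hz).2])] at h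
  refine h.congr_fun ?_
  intro n
  simp [fracSeries, Ring.multichoose_eq, mul_comm]

/-- Evaluation of power series is multiplicative where both factors converge. -/
theorem hasSum_coeff_mul {F G : PowerSeries ℝ} {z a b : ℝ}
    (hF : HasSum (fun n => coeff n F * z ^ n) a) (hG : HasSum (fun n => coeff n G * z ^ n) b) :
    HasSum (fun n => coeff n (F * G) * z ^ n) (a * b) := by
  have hF' := hF.summable.norm
  have hG' := hG.summable.norm
  have h := (summable_norm_sum_mul_antidiagonal_of_summable_norm hF' hG').of_norm.hasSum
  rw [← tsum_mul_tsum_eq_tsum_sum_antidiagonal_of_summable_norm hF' hG', hF.tsum_eq,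
    hG.tsum_eq] at h
  refine h.congr_fun ?_
  intro n
  rw [coeff_mul, Finset.sum_mul]
  refine Finset.sum_congr rfl fun p hp => ?_
  rw [← Finset.HasAntidiagonal.mem_antidiagonal.1 hp, pow_add]
  ring

theorem hasSum_coeff_C_mul_X (ν z : ℝ) :
    HasSum (fun n => coeff n (C ν * X : PowerSeries ℝ) * z ^ n) (ν * z) := by
  convert! hasSum_single (f := fun n => coeff n (C ν * X : PowerSeries ℝ) * z ^ n) 1 ?_ using 1
  · simp
  · intro n hn
    simp [coeff_X, hn]

theorem hasSum_coeff_one (z : ℝ) :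
    HasSum (fun n => coeff n (1 : PowerSeries ℝ) * z ^ n) 1 := by
  convert! hasSum_single (f := fun n => coeff n (1 : PowerSeries ℝ) * z ^ n) 0 ?_ using 1
  · simp
  · intro n hn
    simp [coeff_one, hn]

theorem hasSum_coeff_add {F G : PowerSeries ℝ} {z a b : ℝ}
    (hF : HasSum (fun n => coeff n F * z ^ n) a) (hG : HasSum (fun n => coeff n G * z ^ n) b) :
    HasSum (fun n => coeff n (F + G) * z ^ n) (a + b) := by
  simpa [add_mul] using hF.add hG

/-- The Cauchy product of a summable sequence with a null sequence is a null sequence. -/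
theorem tendsto_coeff_mul_zero {G F : PowerSeries ℝ}
    (hG : Summable fun n => |coeff n G|) (hF : Tendsto (fun n => coeff n F) atTop (𝓝 0)) :
    Tendsto (fun n => coeff n (G * F)) atTop (𝓝 0) := by
  obtain ⟨M, hM⟩ := hF.norm.bddAbove_range
  have hM' : ∀ n, |coeff n F| ≤ M := fun n => hM ⟨n, rfl⟩
  have hM0 : 0 ≤ M := (abs_nonneg _).trans (hM' 0)
  have h := tendsto_tsum_of_dominated_convergence (𝓕 := atTop) (g := fun _ : ℕ => (0 : ℝ))
    (f := fun n i => if i ≤ n then coeff i G * coeff (n - i) F else 0)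
    (hG.mul_right M) ?_ ?_
  · rw [tsum_zero] at h
    refine h.congr fun n => ?_
    rw [coeff_mul, Finset.Nat.sum_antidiagonal_eq_sum_range_succ_mk,
      tsum_eq_sum (s := Finset.range (n + 1))]
    · refine Finset.sum_congr rfl fun i hi => ?_
      rw [if_pos (by simpa [Nat.lt_succ_iff] using hi)]
    · intro i hi
      rw [if_neg (by simpa [Nat.lt_succ_iff] using hi)]
  · intro i
    have h1 : Tendsto (fun n => coeff i G * coeff (n - i) F) atTop (𝓝 (coeff i G * 0)) :=
      (hF.comp (tendsto_sub_atTop_nat i)).const_mul _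
    rw [mul_zero] at h1
    refine h1.congr' ?_
    filter_upwards [eventually_ge_atTop i] with n hn
    rw [if_pos hn]
  · refine Eventually.of_forall fun n i => ?_
    split_ifs
    · rw [norm_mul]
      exact mul_le_mul_of_nonneg_left (hM' _) (abs_nonneg _)
    · simpa using mul_nonneg (abs_nonneg _) hM0

/-- If the coefficients `c` are nonnegative with sum at most `q < 1`, then `1 / (1 - ∑ cₙ zⁿ)`
has absolutely summable coefficients. -/
theorem summable_abs_coeff_of_mul_one_sub_eq_one {c G : PowerSeries ℝ} {q : ℝ} (hq : q < 1)
    (hc : ∀ n, 0 ≤ coeff n c) (hcq : ∀ n, ∑ i ∈ Finset.range n, coeff i c ≤ q)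
    (hG : (1 - c) * G = 1) : Summable fun n => |coeff n G| := by
  have hrec : ∀ n, |coeff n G| ≤ (if n = 0 then 1 else 0) +
      ∑ p ∈ Finset.HasAntidiagonal.antidiagonal n, coeff p.1 c * |coeff p.2 G| := by
    intro n
    have h : G = 1 + c * G := by linear_combination hG
    have h' : coeff n G = (if n = 0 then 1 else 0) +
        ∑ p ∈ Finset.HasAntidiagonal.antidiagonal n, coeff p.1 c * coeff p.2 G := by
      conv_lhs => rw [h]
      rw [map_add, coeff_one, coeff_mul]
    rw [h']
    refine (abs_add_le _ _).trans (add_le_add ?_ ((Finset.abs_sum_le_sum_abs _ _).trans ?_))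
    · split_ifs <;> simp
    · refine Finset.sum_le_sum fun p _ => ?_
      rw [abs_mul, abs_of_nonneg (hc _)]
  refine summable_of_sum_range_le (c := 1 / (1 - q)) (fun _ => abs_nonneg _) fun n => ?_
  have hnn : 0 ≤ ∑ i ∈ Finset.range n, |coeff i G| := Finset.sum_nonneg fun _ _ => abs_nonneg _
  have h1 : ∑ i ∈ Finset.range n, |coeff i G| ≤
      1 + (∑ i ∈ Finset.range n, coeff i c) * ∑ i ∈ Finset.range n, |coeff i G| := by
    refine (Finset.sum_le_sum fun i _ => hrec i).trans ?_
    rw [Finset.sum_add_distrib]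
    refine add_le_add ?_ ?_
    · rw [Finset.sum_ite_eq']
      split_ifs <;> simp
    · simp_rw [Finset.Nat.sum_antidiagonal_eq_sum_range_succ_mk]
      rw [Finset.sum_comm' (t' := Finset.range n) (s' := fun i => Finset.Ico i n), Finset.sum_mul]
      · refine Finset.sum_le_sum fun i _ => ?_
        rw [← Finset.mul_sum]
        refine mul_le_mul_of_nonneg_left ?_ (hc i)
        rw [Finset.sum_Ico_eq_sum_range]
        simp only [Nat.add_sub_cancel_left]
        exact Finset.sum_le_sum_of_subset_of_nonneg
          (Finset.range_subset_range.2 (Nat.sub_le n i)) fun _ _ _ => abs_nonneg _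
      · intro a b
        simp only [Finset.mem_range, Finset.mem_Ico]
        omega
  rw [le_div_iff₀ (by linarith)]
  nlinarith [mul_le_mul_of_nonneg_right (hcq n) hnn]
end FracCML

/-! ### Beta moments and the factorization of the symbol -/

namespace FracCML

open PowerSeries Filter Topology MeasureTheory ProbabilityTheory

theorem ae_betaMeasure_mem_Ioo (a b : ℝ) : ∀ᵐ v ∂betaMeasure a b, v ∈ Set.Ioo (0 : ℝ) 1 := by
  have hm : Measurable (betaPDF a b) := (measurable_betaPDFReal a b).ennreal_ofReal
  rw [betaMeasure, ae_withDensity_iff hm]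
  refine Eventually.of_forall fun v hv => ⟨?_, ?_⟩
  · by_contra h
    exact hv (betaPDF_eq_zero_of_nonpos (not_lt.1 h))
  · by_contra h
    exact hv (betaPDF_eq_zero_of_one_le (not_lt.1 h))

theorem betaPDFReal_nonneg {a b : ℝ} (ha : 0 < a) (hb : 0 < b) (v : ℝ) :
    0 ≤ betaPDFReal a b v := by
  by_cases h : 0 < v ∧ v < 1
  · exact (betaPDFReal_pos h.1 h.2 ha hb).le
  · rw [betaPDFReal, if_neg h]

theorem integral_betaPDFReal {a b : ℝ} (ha : 0 < a) (hb : 0 < b) :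
    ∫ v, betaPDFReal a b v = 1 := by
  rw [integral_eq_lintegral_of_nonneg_ae (Eventually.of_forall (betaPDFReal_nonneg ha hb))
    (by fun_prop)]
  change (∫⁻ v, betaPDF a b v).toReal = 1
  rw [lintegral_betaPDF_eq_one ha hb, ENNReal.toReal_one]

theorem integral_pow_betaMeasure {a b : ℝ} (ha : 0 < a) (hb : 0 < b) (n : ℕ) :
    ∫ v, v ^ n ∂betaMeasure a b = beta (a + n) b / beta a b := by
  have hm : Measurable (betaPDF a b) := (measurable_betaPDFReal a b).ennreal_ofReal
  rw [betaMeasure, integral_withDensity_eq_integral_toReal_smul hm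
    (Eventually.of_forall fun v => ENNReal.ofReal_lt_top)]
  have han : 0 < a + n := by positivity
  have h1 : ∀ v, (betaPDF a b v).toReal • v ^ n =
      beta (a + n) b / beta a b * betaPDFReal (a + n) b v := by
    intro v
    rw [betaPDF, ENNReal.toReal_ofReal (betaPDFReal_nonneg ha hb v), smul_eq_mul, betaPDFReal,
      betaPDFReal]
    split_ifs with hv
    · have h2 := (beta_pos ha hb).ne'
      have h3 := (beta_pos han hb).ne'
      rw [show a + n - 1 = (a - 1) + n by ring, Real.rpow_add_natCast hv.1.ne']
      field_simp
    · simp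
  simp_rw [h1]
  rw [integral_const_mul, integral_betaPDFReal han hb, mul_one]

variable {α : ℝ}

/-- The coefficients of `(1 - z) ^ (α - 1)` are the moments of a beta distribution. -/
theorem coeff_fracSeries_one_sub (h0 : 0 < α) (h1 : α < 1) (n : ℕ) :
    coeff n (fracSeries (1 - α)) = ∫ v, v ^ n ∂betaMeasure (1 - α) α := by
  have h1' : 0 < 1 - α := by linarith
  rw [integral_pow_betaMeasure h1' h0, coeff_fracSeries, kernel, beta, beta]
  · have e1 : 1 - α + n + α = n + 1 := by ring
    have e2 := (Real.Gamma_pos_of_pos h1').ne'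
    have e3 := (Real.Gamma_pos_of_pos h0).ne'
    have e4 := (Real.Gamma_pos_of_pos (by positivity : (0 : ℝ) < n + 1)).ne'
    rw [e1, sub_add_cancel, Real.Gamma_one, add_comm (n : ℝ) (1 - α)]
    field_simp
  · intro m hm
    have : (0 : ℝ) ≤ m := by positivity
    linarith

/-- The coefficients of `-(1 - z) ^ α` are, up to the factor `α` and a shift, the moments of a
beta distribution. -/
theorem coeff_succ_fracSeries_neg (h0 : 0 < α) (h1 : α < 1) (n : ℕ) :
    coeff (n + 1) (fracSeries (-α)) = -(α * ∫ v, v ^ n ∂betaMeasure (1 - α) (1 + α)) := by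
  have h1' : 0 < 1 - α := by linarith
  have hα : ∀ m : ℕ, -α ≠ -m := by
    intro m hm
    have hm' : α = m := by linarith
    rw [hm'] at h0 h1
    norm_cast at h0 h1
    omega
  rw [integral_pow_betaMeasure h1' (by linarith), coeff_fracSeries hα, kernel, beta, beta]
  have e1 : 1 - α + n + (1 + α) = n + 1 + 1 := by ring
  have e2 := (Real.Gamma_pos_of_pos h1').ne'
  have e3 := (Real.Gamma_pos_of_pos (by linarith : 0 < 1 + α)).ne'
  have e4 := (Real.Gamma_pos_of_pos (by positivity : (0 : ℝ) < n + 1 + 1)).ne'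
  have e5 : Real.Gamma (1 - α) = -α * Real.Gamma (-α) := by
    rw [← Real.Gamma_add_one (by linarith : -α ≠ 0)]
    congr 1
    ring
  have e6 : Real.Gamma (-α) ≠ 0 := Real.Gamma_ne_zero hα
  have e7 : (1 - α) + (1 + α) = 1 + 1 := by ring
  rw [e1, e7, Real.Gamma_add_one one_ne_zero, Real.Gamma_one, Nat.cast_succ,
    show (n : ℝ) + 1 + -α = 1 - α + n by ring, e5]
  field_simp

theorem coeff_fracSeries_one_sub_nonneg (h0 : 0 < α) (h1 : α < 1) (n : ℕ) :
    0 ≤ coeff n (fracSeries (1 - α)) := by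
  rw [coeff_fracSeries_one_sub h0 h1]
  refine integral_nonneg_of_ae ?_
  filter_upwards [ae_betaMeasure_mem_Ioo _ _] with v hv using pow_nonneg hv.1.le n

theorem tendsto_coeff_fracSeries_one_sub (h0 : 0 < α) (h1 : α < 1) :
    Tendsto (fun n => coeff n (fracSeries (1 - α))) atTop (𝓝 0) := by
  have := isProbabilityMeasureBeta (by linarith : 0 < 1 - α) h0
  simp_rw [coeff_fracSeries_one_sub h0 h1]
  rw [← integral_zero ℝ ℝ (μ := betaMeasure (1 - α) α)]
  refine tendsto_integral_of_dominated_convergence (fun _ => 1) (fun n => by fun_prop)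
    (integrable_const _) (fun n => ?_) ?_
  · filter_upwards [ae_betaMeasure_mem_Ioo _ _] with v hv
    rw [norm_pow, Real.norm_of_nonneg hv.1.le]
    exact pow_le_one₀ hv.1.le hv.2.le
  · filter_upwards [ae_betaMeasure_mem_Ioo _ _] with v hv
    exact tendsto_pow_atTop_nhds_zero_of_lt_one hv.1.le hv.2

/-- The value of `ν` for which `(1 - z) ^ α + ν z` vanishes at `z = -1 / ρ`, in the integral form
`ν = ρ + α ∫ ρ / (v + ρ)`. -/
noncomputable def rootValue (α ρ : ℝ) : ℝ :=
  ρ + α * ∫ v, ρ / (v + ρ) ∂betaMeasure (1 - α) (1 + α)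

/-- The power series `C` in the factorization
`(1 - z) ^ α + ν z = (1 + ρ z) (1 - C(z))`. -/
noncomputable def quotientSeries (α ρ : ℝ) : PowerSeries ℝ :=
  PowerSeries.mk fun n =>
    if n = 0 then 0 else α * ∫ v, v ^ n / (v + ρ) ∂betaMeasure (1 - α) (1 + α)

theorem integrable_betaMeasure_of_bounded {a b : ℝ} (ha : 0 < a) (hb : 0 < b) {f : ℝ → ℝ}
    (hf : Measurable f) {M : ℝ} (hM : ∀ v ∈ Set.Ioo (0 : ℝ) 1, |f v| ≤ M) :
    Integrable f (betaMeasure a b) := by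
  have := isProbabilityMeasureBeta ha hb
  refine Integrable.of_bound hf.aestronglyMeasurable M ?_
  filter_upwards [ae_betaMeasure_mem_Ioo a b] with v hv using hM v hv

theorem integrable_pow_div (h0 : 0 < α) (h1 : α < 1) {ρ : ℝ} (hρ : 0 < ρ) (n : ℕ) :
    Integrable (fun v => v ^ n / (v + ρ)) (betaMeasure (1 - α) (1 + α)) := by
  refine integrable_betaMeasure_of_bounded (by linarith) (by linarith) (by fun_prop)
    (M := 1 / ρ) fun v hv => ?_
  have h2 : 0 < v + ρ := by linarith [hv.1]
  rw [abs_of_nonneg (div_nonneg (pow_nonneg hv.1.le n) h2.le)]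
  exact div_le_div₀ zero_le_one (pow_le_one₀ hv.1.le hv.2.le) hρ (by linarith [hv.1])

theorem coeff_quotientSeries_nonneg (h0 : 0 < α) {ρ : ℝ} (hρ : 0 < ρ) (n : ℕ) :
    0 ≤ coeff n (quotientSeries α ρ) := by
  rw [quotientSeries, coeff_mk]
  split_ifs
  · rfl
  · refine mul_nonneg h0.le (integral_nonneg_of_ae ?_)
    filter_upwards [ae_betaMeasure_mem_Ioo _ _] with v hv
    exact div_nonneg (pow_nonneg hv.1.le n) (by linarith [hv.1])

/-- The factorization `(1 + ρ z) (1 - C(z)) = (1 - z) ^ α + ν z` with `ν = rootValue α ρ`. In terms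
of moments it is the identity `v ^ (n + 1) / (v + ρ) + ρ v ^ n / (v + ρ) = v ^ n`. -/
theorem one_add_mul_one_sub_quotientSeries (h0 : 0 < α) (h1 : α < 1) {ρ : ℝ} (hρ : 0 < ρ) :
    (1 + C ρ * X) * (1 - quotientSeries α ρ) =
      fracSeries (-α) + C (rootValue α ρ) * X := by
  have hP := isProbabilityMeasureBeta (by linarith : 0 < 1 - α) (by linarith : 0 < 1 + α)
  have hi := fun n => integrable_pow_div h0 h1 hρ n
  have hstep : ∀ n : ℕ, ∫ v, v ^ n ∂betaMeasure (1 - α) (1 + α) =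
      ∫ v, v ^ (n + 1) / (v + ρ) ∂betaMeasure (1 - α) (1 + α) +
        ρ * ∫ v, v ^ n / (v + ρ) ∂betaMeasure (1 - α) (1 + α) := by
    intro n
    rw [← integral_const_mul, ← integral_add (hi _) ((hi _).const_mul _)]
    refine integral_congr_ae ?_
    filter_upwards [ae_betaMeasure_mem_Ioo _ _] with v hv
    have : v + ρ ≠ 0 := by linarith [hv.1]
    field_simp
    ring
  have hroot : rootValue α ρ =
      ρ + α * (ρ * ∫ v, v ^ 0 / (v + ρ) ∂betaMeasure (1 - α) (1 + α)) := by
    have h : ∀ v, ρ / (v + ρ) = ρ * (v ^ 0 / (v + ρ)) := fun v => by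
      rw [pow_zero, mul_one_div]
    simp_rw [rootValue, h]
    rw [integral_const_mul]
  ext n
  rw [add_mul, one_mul, mul_assoc, map_add, map_add, coeff_C_mul, coeff_C_mul]
  rcases n with _ | _ | n
  · rw [coeff_zero_X_mul, coeff_zero_fracSeries, coeff_zero_X, map_sub, quotientSeries, coeff_mk]
    simp
  · rw [coeff_succ_X_mul, coeff_succ_fracSeries_neg h0 h1, hroot, hstep]
    simp [quotientSeries, coeff_one, coeff_X]
    ring
  · rw [coeff_succ_X_mul, coeff_succ_fracSeries_neg h0 h1, hstep]
    simp [quotientSeries, coeff_one, coeff_X]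
    ring

/-- The bound for the partial sums is read off from the identity obtained by multiplying the
factorization by `1 / (1 - z)`. -/
theorem sum_coeff_quotientSeries_le (h0 : 0 < α) (h1 : α < 1) {ρ : ℝ} (hρ : 0 < ρ) (n : ℕ) :
    ∑ i ∈ Finset.range n, coeff i (quotientSeries α ρ) ≤ 1 - rootValue α ρ / (1 + ρ) := by
  set c := quotientSeries α ρ with hc
  have hcoef : ∀ m, coeff m (fracSeries 1 * (1 - c)) =
      1 - ∑ i ∈ Finset.range (m + 1), coeff i c := by
    intro m
    rw [mul_sub, mul_one, map_sub, coeff_fracSeries_one, mul_comm, coeff_mul,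
      Finset.Nat.sum_antidiagonal_eq_sum_range_succ_mk]
    simp [coeff_fracSeries_one]
  have h := congrArg (fun F => fracSeries 1 * F) (one_add_mul_one_sub_quotientSeries h0 h1 hρ)
  rw [mul_add, ← fracSeries_add, ← sub_eq_add_neg, ← hc] at h
  have hn := congrArg (coeff (n + 1)) h
  rw [show fracSeries 1 * ((1 + C ρ * X) * (1 - c)) = fracSeries 1 * (1 - c) +
      C ρ * (X * (fracSeries 1 * (1 - c))) by ring,
    show fracSeries 1 * (C (rootValue α ρ) * X) = C (rootValue α ρ) * (X * fracSeries 1) by ring,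
    map_add, map_add, coeff_C_mul, coeff_C_mul, coeff_succ_X_mul, coeff_succ_X_mul, hcoef, hcoef,
    coeff_fracSeries_one, Finset.sum_range_succ _ (n + 1), Finset.sum_range_succ _ n] at hn
  have hf := coeff_fracSeries_one_sub_nonneg h0 h1 (n + 1)
  have hc0 := coeff_quotientSeries_nonneg h0 hρ n
  have hc1 := coeff_quotientSeries_nonneg h0 hρ (n + 1)
  rw [← hc] at hc0 hc1
  rw [le_sub_comm, div_le_iff₀ (by linarith)]
  nlinarith [mul_nonneg hρ.le hc0]

theorem rootValue_zero : rootValue α 0 = 0 := by simp [rootValue]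

theorem rootValue_pos (h0 : 0 < α) {ρ : ℝ} (hρ : 0 < ρ) : 0 < rootValue α ρ := by
  refine add_pos_of_pos_of_nonneg hρ (mul_nonneg h0.le (integral_nonneg_of_ae ?_))
  filter_upwards [ae_betaMeasure_mem_Ioo _ _] with v hv
  exact div_nonneg hρ.le (by linarith [hv.1])

theorem continuousOn_rootValue (h0 : 0 < α) (h1 : α < 1) :
    ContinuousOn (rootValue α) (Set.Ici 0) := by
  have hP := isProbabilityMeasureBeta (by linarith : 0 < 1 - α) (by linarith : 0 < 1 + α)
  refine continuousOn_id.add (continuousOn_const.mul ?_)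
  refine continuousOn_of_dominated (bound := fun _ => 1)
    (fun ρ _ => Measurable.aestronglyMeasurable (by fun_prop)) ?_ (integrable_const _) ?_
  · intro ρ hρ
    filter_upwards [ae_betaMeasure_mem_Ioo _ _] with v hv
    have hρ' : 0 ≤ ρ := hρ
    rw [Real.norm_of_nonneg (div_nonneg hρ (by linarith [hv.1]))]
    exact div_le_one_of_le₀ (by linarith [hv.1]) (by linarith [hv.1])
  · filter_upwards [ae_betaMeasure_mem_Ioo _ _] with v hv
    refine continuousOn_id.div (by fun_prop) fun ρ hρ => ?_
    have hρ' : 0 ≤ ρ := hρ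
    linarith [hv.1]

/-- For `ρ > 1` the point `-1 / ρ` lies in the disc of convergence, so that the factorization can
be evaluated there. -/
theorem rootValue_eq_of_one_lt (h0 : 0 < α) (h1 : α < 1) {ρ : ℝ} (hρ : 1 < ρ) :
    rootValue α ρ = ρ * (1 + 1 / ρ) ^ α := by
  have hρ0 : 0 < ρ := by linarith
  have hz : |(-(1 / ρ))| < 1 := by
    rw [abs_neg, abs_of_pos (by positivity), div_lt_one hρ0]
    exact hρ
  have hcs : Summable fun n => coeff n (quotientSeries α ρ) :=
    summable_of_sum_range_le (coeff_quotientSeries_nonneg h0 hρ0)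
      (sum_coeff_quotientSeries_le h0 h1 hρ0)
  have hC : Summable fun n => coeff n (1 - quotientSeries α ρ) * (-(1 / ρ)) ^ n := by
    have h2 : Summable fun n => coeff n (quotientSeries α ρ) * (-(1 / ρ)) ^ n := by
      refine Summable.of_norm_bounded hcs fun n => ?_
      rw [norm_mul, norm_pow, Real.norm_of_nonneg (coeff_quotientSeries_nonneg h0 hρ0 n)]
      exact mul_le_of_le_one_right (coeff_quotientSeries_nonneg h0 hρ0 n)
        (pow_le_one₀ (abs_nonneg _) hz.le)
    simpa [sub_mul] using (hasSum_coeff_one _).summable.sub h2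
  have hL := hasSum_coeff_mul (hasSum_coeff_add (hasSum_coeff_one (-(1 / ρ)))
    (hasSum_coeff_C_mul_X ρ (-(1 / ρ)))) hC.hasSum
  rw [one_add_mul_one_sub_quotientSeries h0 h1 hρ0] at hL
  have hR := hasSum_coeff_add (hasSum_fracSeries (-α) hz)
    (hasSum_coeff_C_mul_X (rootValue α ρ) (-(1 / ρ)))
  have h := hL.unique hR
  have e : 1 + ρ * -(1 / ρ) = 0 := by field_simp; ring
  rw [e, zero_mul, neg_neg, sub_neg_eq_add] at h
  have h' : rootValue α ρ * (1 / ρ) = (1 + 1 / ρ) ^ α := by linarith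
  rw [← h']
  field_simp

theorem rootValue_one (h0 : 0 < α) (h1 : α < 1) : rootValue α 1 = 2 ^ α := by
  have hl : Tendsto (rootValue α) (𝓝[>] 1) (𝓝 (rootValue α 1)) :=
    ((continuousOn_rootValue h0 h1) 1 (by simp)).mono_left
      (nhdsWithin_mono _ fun x hx => (zero_le_one.trans (le_of_lt hx) : (0 : ℝ) ≤ x))
  have hr : Tendsto (fun ρ : ℝ => ρ * (1 + 1 / ρ) ^ α) (𝓝[>] 1) (𝓝 (2 ^ α)) := by
    have hc : ContinuousAt (fun ρ : ℝ => ρ * (1 + 1 / ρ) ^ α) 1 :=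
      continuousAt_id.mul ((continuousAt_const.add
        (continuousAt_const.div continuousAt_id one_ne_zero)).rpow_const (Or.inr h0.le))
    have := hc.tendsto.mono_left (nhdsWithin_le_nhds (s := Set.Ioi 1))
    norm_num at this
    simpa using this
  refine tendsto_nhds_unique hl (hr.congr' ?_)
  filter_upwards [self_mem_nhdsWithin] with ρ hρ
  exact (rootValue_eq_of_one_lt h0 h1 hρ).symm

theorem exists_rootValue_eq (h0 : 0 < α) (h1 : α < 1) {ν : ℝ} (hν0 : 0 < ν) (hν : ν < 2 ^ α) :
    ∃ ρ, 0 < ρ ∧ ρ < 1 ∧ rootValue α ρ = ν := by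
  have h := intermediate_value_Ioo (zero_le_one' ℝ)
    ((continuousOn_rootValue h0 h1).mono Set.Icc_subset_Ici_self)
  rw [rootValue_zero, rootValue_one h0 h1] at h
  obtain ⟨ρ, hρ, rfl⟩ := h ⟨hν0, hν⟩
  exact ⟨ρ, hρ.1, hρ.2, rfl⟩

end FracCML

/-! ### The scalar system -/

namespace FracCML

open PowerSeries Filter Topology

/-- The solution with initial value `1` of the scalar system
`u_{t+1} = u_0 + μ ∑_{j=0}^{t} Γ(t-j+α) / (Γ(α) Γ(t-j+1)) u_j`. -/
noncomputable def fundamentalSolution (α μ : ℝ) : ℕ → ℝ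
  | 0 => 1
  | t + 1 => 1 + μ * ∑ j : Fin (t + 1), kernel α (t - j) * fundamentalSolution α μ j
decreasing_by exact j.2

theorem fundamentalSolution_zero (α μ : ℝ) : fundamentalSolution α μ 0 = 1 := by
  rw [fundamentalSolution]

theorem fundamentalSolution_succ (α μ : ℝ) (t : ℕ) :
    fundamentalSolution α μ (t + 1) =
      1 + μ * ∑ j ∈ Finset.range (t + 1), kernel α (t - j) * fundamentalSolution α μ j := by
  rw [fundamentalSolution, Finset.sum_range]

/-- Complex solutions are allowed, as the Fourier coefficients of a real solution are complex. -/
theorem eq_fundamentalSolution_mul {α μ : ℝ} {x : ℕ → ℂ}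
    (hx : ∀ t, x (t + 1) = x 0 + μ * ∑ j ∈ Finset.range (t + 1), (kernel α (t - j) : ℂ) * x j)
    (t : ℕ) : x t = fundamentalSolution α μ t * x 0 := by
  induction t using Nat.strong_induction_on with
  | _ t ih =>
    cases t with
    | zero => simp [fundamentalSolution_zero]
    | succ t =>
      rw [hx, fundamentalSolution_succ]
      push_cast
      rw [add_mul, one_mul, mul_assoc, Finset.sum_mul]
      congr 2
      refine Finset.sum_congr rfl fun j hj => ?_
      rw [ih j (Finset.mem_range.1 hj), mul_assoc]

variable {α : ℝ}

theorem kernel_nonneg (h0 : 0 < α) (n : ℕ) : 0 ≤ kernel α n := by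
  unfold kernel
  have h1 : 0 < Real.Gamma (n + α) := Real.Gamma_pos_of_pos (by positivity)
  have h2 := Real.Gamma_pos_of_pos h0
  have h3 : 0 < Real.Gamma ((n : ℝ) + 1) := Real.Gamma_pos_of_pos (by positivity)
  positivity

/-- The scalar system in terms of its generating function `U`:
`((1 - z) ^ α - μ z) U(z) = (1 - z) ^ (α - 1)`. -/
theorem genFun_identity (h0 : 0 < α) (μ : ℝ) :
    (fracSeries (-α) + C (-μ) * X) * PowerSeries.mk (fundamentalSolution α μ) =
      fracSeries (1 - α) := by
  have hα : ∀ m : ℕ, α ≠ -m := fun m hm => by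
    have : (0 : ℝ) ≤ m := by positivity
    linarith
  set U := PowerSeries.mk (fundamentalSolution α μ) with hU
  have h : U = fracSeries 1 + C μ * (X * (fracSeries α * U)) := by
    ext n
    rw [map_add, coeff_C_mul, coeff_fracSeries_one, hU, coeff_mk]
    cases n with
    | zero => rw [coeff_zero_X_mul, fundamentalSolution_zero, mul_zero, add_zero]
    | succ n =>
      rw [coeff_succ_X_mul, fundamentalSolution_succ, mul_comm (fracSeries α), coeff_mul,
        Finset.Nat.sum_antidiagonal_eq_sum_range_succ_mk]
      congr 2
      refine Finset.sum_congr rfl fun j _ => ?_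
      rw [coeff_mk, coeff_fracSeries hα, mul_comm]
  have hinv : fracSeries (-α) * fracSeries α = 1 := by
    rw [← fracSeries_add, neg_add_cancel, fracSeries_zero]
  have h1 : fracSeries (1 - α) = fracSeries (-α) * fracSeries 1 := by
    rw [← fracSeries_add]
    congr 1
    ring
  rw [h1, map_neg]
  linear_combination fracSeries (-α) * h + C μ * X * U * hinv

/-- The generating function is `1 / (1 + ρ z)` times `1 / (1 - C(z))` times `(1 - z) ^ (α - 1)`: two
series with absolutely summable coefficients and one whose coefficients tend to `0`. -/
theorem tendsto_fundamentalSolution_zero (h0 : 0 < α) (h1 : α < 1) {μ : ℝ} (hμ : -2 ^ α < μ)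
    (hμ0 : μ < 0) : Tendsto (fundamentalSolution α μ) atTop (𝓝 0) := by
  obtain ⟨ρ, hρ, hρ1, hν⟩ := exists_rootValue_eq h0 h1 (ν := -μ) (by linarith) (by linarith)
  have hgen := genFun_identity h0 μ
  rw [← hν, ← one_add_mul_one_sub_quotientSeries h0 h1 hρ] at hgen
  set U := PowerSeries.mk (fundamentalSolution α μ) with hU
  have hc0 : constantCoeff (1 - quotientSeries α ρ) ≠ 0 := by
    simp [quotientSeries, ← coeff_zero_eq_constantCoeff_apply, -coeff_zero_eq_constantCoeff]
  have hG := PowerSeries.mul_inv_cancel _ hc0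
  have hGs := summable_abs_coeff_of_mul_one_sub_eq_one
    (q := 1 - rootValue α ρ / (1 + ρ))
    (by have := div_pos (rootValue_pos h0 hρ) (by linarith : 0 < 1 + ρ); linarith)
    (coeff_quotientSeries_nonneg h0 hρ) (sum_coeff_quotientSeries_le h0 h1 hρ) hG
  -- the geometric series `1 / (1 + ρ z)`
  have hW : (1 + C ρ * X) * PowerSeries.mk (fun n => (-ρ) ^ n) = 1 := by
    ext n
    rw [add_mul, one_mul, mul_assoc, map_add, coeff_C_mul, coeff_mk]
    cases n with
    | zero => simp
    | succ n =>
      rw [coeff_succ_X_mul, coeff_mk, coeff_one, if_neg n.succ_ne_zero]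
      ring
  have hWs : Summable fun n => |coeff n (PowerSeries.mk fun n => (-ρ) ^ n)| := by
    simpa [abs_pow, abs_of_pos hρ] using summable_geometric_of_lt_one hρ.le hρ1
  have hlim := tendsto_coeff_mul_zero hWs
    (tendsto_coeff_mul_zero hGs (tendsto_coeff_fracSeries_one_sub h0 h1))
  have hsol : PowerSeries.mk (fun n => (-ρ) ^ n) *
      ((1 - quotientSeries α ρ)⁻¹ * fracSeries (1 - α)) = U := by
    rw [← hgen]
    linear_combination (PowerSeries.mk (fun n => (-ρ) ^ n) * (1 + C ρ * X) * U) * hG + U * hW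
  rw [hsol] at hlim
  simpa [hU] using hlim

/-- For `μ ≥ 0` the solution stays above its initial value. -/
theorem one_le_fundamentalSolution (h0 : 0 < α) {μ : ℝ} (hμ : 0 ≤ μ) (t : ℕ) :
    1 ≤ fundamentalSolution α μ t := by
  induction t using Nat.strong_induction_on with
  | _ t ih =>
    cases t with
    | zero => rw [fundamentalSolution_zero]
    | succ t =>
      rw [fundamentalSolution_succ]
      refine le_add_of_nonneg_right (mul_nonneg hμ (Finset.sum_nonneg fun j hj => ?_))
      exact mul_nonneg (kernel_nonneg h0 _) (zero_le_one.trans (ih j (Finset.mem_range.1 hj)))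

/-- The generating function of a null sequence is `o(1 / (1 - s))` as `s → 1`. -/
theorem tendsto_one_sub_mul_tsum {a : ℕ → ℝ} (ha : Tendsto a atTop (𝓝 0)) :
    Tendsto (fun s : ℝ => (1 - s) * ∑' n, a n * s ^ n) (𝓝[<] 1) (𝓝 0) := by
  -- `(1 - s) ∑ aₙ sⁿ` is the power series of the differences of `a`, whose partial sums are `a`
  let d : ℕ → ℝ := fun n => a n - if n = 0 then 0 else a (n - 1)
  have hd : Tendsto (fun n => ∑ i ∈ Finset.range n, d i) atTop (𝓝 0) := by
    rw [← tendsto_add_atTop_iff_nat 1]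
    refine ha.congr fun n => ?_
    induction n with
    | zero => simp [d]
    | succ n ih => rw [Finset.sum_range_succ, ← ih]; simp [d]
  refine (Real.tendsto_tsum_powerSeries_nhdsWithin_lt hd).congr' ?_
  filter_upwards [Ioo_mem_nhdsLT (zero_lt_one' ℝ)] with s hs
  obtain ⟨M, hM⟩ := ha.norm.bddAbove_range
  have hsum : Summable fun n => a n * s ^ n := by
    refine Summable.of_norm_bounded ((summable_geometric_of_lt_one hs.1.le hs.2).mul_left M)
      fun n => ?_
    rw [norm_mul, norm_pow, Real.norm_of_nonneg hs.1.le]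
    exact mul_le_mul_of_nonneg_right (hM ⟨n, rfl⟩) (pow_nonneg hs.1.le n)
  have hshift : HasSum (fun n => (if n = 0 then 0 else a (n - 1)) * s ^ n)
      (s * ∑' n, a n * s ^ n) := by
    rw [← hasSum_nat_add_iff' 1]
    simpa [pow_succ, mul_comm, mul_assoc, mul_left_comm] using hsum.hasSum.mul_left s
  have h := (hsum.hasSum.sub hshift).tsum_eq
  simp only [d, sub_mul] at h ⊢
  rw [h]
  ring

/-- If `μ ≤ -2 ^ α`, then `(1 + s) ^ α + μ s` has a zero in `(0, 1)` or vanishes to first order at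
`1`, which is incompatible with the generating function of a null sequence. -/
theorem not_tendsto_fundamentalSolution (h0 : 0 < α) (h1 : α < 1) {μ : ℝ}
    (hμ : μ ≤ -2 ^ α) : ¬ Tendsto (fundamentalSolution α μ) atTop (𝓝 0) := by
  intro hu
  obtain ⟨M, hM⟩ := hu.norm.bddAbove_range
  have heval : ∀ s ∈ Set.Ioo (0 : ℝ) 1, ((1 + s) ^ α + μ * s) *
      (∑' n, (-1) ^ n * fundamentalSolution α μ n * s ^ n) = (1 + s) ^ (α - 1) := by
    intro s hs
    have hz : |-s| < 1 := by rw [abs_neg, abs_of_pos hs.1]; exact hs.2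
    have hsum : Summable fun n => fundamentalSolution α μ n * (-s) ^ n := by
      refine Summable.of_norm_bounded ((summable_geometric_of_lt_one hs.1.le hs.2).mul_left M)
        fun n => ?_
      rw [norm_mul, norm_pow, norm_neg, Real.norm_of_nonneg hs.1.le]
      exact mul_le_mul_of_nonneg_right (hM ⟨n, rfl⟩) (pow_nonneg hs.1.le n)
    have hU : HasSum (fun n => coeff n (PowerSeries.mk (fundamentalSolution α μ)) * (-s) ^ n)
        (∑' n, fundamentalSolution α μ n * (-s) ^ n) := by
      simpa using hsum.hasSum
    have h := hasSum_coeff_mul (hasSum_coeff_add (hasSum_fracSeries (-α) hz)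
      (hasSum_coeff_C_mul_X (-μ) (-s))) hU
    rw [genFun_identity h0] at h
    have h' := h.unique (hasSum_fracSeries (1 - α) hz)
    have e : ∀ n, fundamentalSolution α μ n * (-s) ^ n =
        (-1) ^ n * fundamentalSolution α μ n * s ^ n := fun n => by
      rw [neg_pow]; ring
    simp_rw [e] at h'
    rw [neg_neg, neg_mul_neg, neg_sub, sub_neg_eq_add] at h'
    exact h'
  rcases hμ.lt_or_eq with hlt | heq
  · have hc : ContinuousOn (fun s : ℝ => (1 + s) ^ α + μ * s) (Set.Icc 0 1) := by
      refine ContinuousOn.add (ContinuousOn.rpow_const (by fun_prop) fun _ _ => Or.inr h0.le)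
        (by fun_prop)
    have hivt := intermediate_value_Ioo' (zero_le_one' ℝ) hc
    obtain ⟨s, hs, hs0⟩ := hivt (show (0 : ℝ) ∈ _ by
      constructor
      · norm_num
        linarith
      · norm_num)
    have h := heval s hs
    simp only at hs0
    rw [hs0, zero_mul] at h
    exact (Real.rpow_pos_of_pos (by linarith [hs.1]) _).ne h
  · have hw : Tendsto (fun n => (-1) ^ n * fundamentalSolution α μ n) atTop (𝓝 0) := by
      rw [tendsto_zero_iff_norm_tendsto_zero] at hu ⊢
      simpa using hu
    have hlim := (tendsto_one_sub_mul_tsum hw).abs.const_mul (2 ^ α)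
    rw [abs_zero, mul_zero] at hlim
    -- because `0 ≤ (1 + s) ^ α - 2 ^ α s ≤ 2 ^ α (1 - s)`
    have hbound : ∀ᶠ s : ℝ in 𝓝[<] 1, (1 + s) ^ (α - 1) ≤
        2 ^ α * |(1 - s) * ∑' n, (-1) ^ n * fundamentalSolution α μ n * s ^ n| := by
      filter_upwards [Ioo_mem_nhdsLT (zero_lt_one' ℝ)] with s hs
      have hp : (0 : ℝ) < 2 ^ α := by positivity
      have hle : (1 + s) ^ α ≤ 2 ^ α :=
        Real.rpow_le_rpow (by linarith [hs.1]) (by linarith [hs.2]) h0.le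
      have hge : 2 ^ α * s ≤ (1 + s) ^ α := by
        refine le_trans ?_ (Real.rpow_le_rpow (by linarith [hs.1] : (0 : ℝ) ≤ 2 * s)
          (by linarith [hs.2]) h0.le)
        rw [Real.mul_rpow zero_le_two hs.1.le]
        exact mul_le_mul_of_nonneg_left
          (Real.self_le_rpow_of_le_one hs.1.le hs.2.le h1.le) hp.le
      have h := heval s hs
      rw [← abs_of_pos (Real.rpow_pos_of_pos (by linarith [hs.1] : 0 < 1 + s) (α - 1)), ← h,
        abs_mul, abs_mul, ← mul_assoc]
      refine mul_le_mul_of_nonneg_right ?_ (abs_nonneg _)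
      rw [heq, abs_of_nonneg (by linarith), abs_of_nonneg (by linarith [hs.2])]
      linarith
    have hrhs : Tendsto (fun s : ℝ => (1 + s) ^ (α - 1)) (𝓝[<] 1) (𝓝 (2 ^ (α - 1))) := by
      have hc : ContinuousAt (fun s : ℝ => (1 + s) ^ (α - 1)) 1 :=
        (continuousAt_const.add continuousAt_id).rpow_const (Or.inl (by norm_num))
      have := hc.tendsto.mono_left (nhdsWithin_le_nhds (s := Set.Iio 1))
      norm_num at this
      exact this
    have := le_of_tendsto_of_tendsto hrhs hlim hbound
    have hp : (0 : ℝ) < 2 ^ (α - 1) := by positivity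
    linarith

end FracCML

/-! ### Fourier transform on the lattice -/

namespace FracCML

open Filter Topology ZMod

variable {N : ℕ} [NeZero N]

theorem couplingMatrix_mulVec (a₀ a₁ a₂ : ℝ) (x : ZMod N → ℝ) (k : ZMod N) :
    (couplingMatrix N a₀ a₁ a₂ *ᵥ x) k = a₁ * x k + a₂ * x (k + 1) + a₀ * x (k - 1) := by
  simp [couplingMatrix, Matrix.mulVec, dotProduct, add_mul, Finset.sum_add_distrib]

theorem stdAddChar_add_stdAddChar_neg (j : ZMod N) :
    (stdAddChar j : ℂ) + stdAddChar (-j) = 2 * ((stdAddChar j : ℂ).re : ℂ) := by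
  rw [AddChar.map_neg_eq_conj, Complex.add_conj]
  push_cast
  rfl

/-- The eigenvalue `a₁ + 2 a₂ cos (2πj/N)` of the symmetric coupling matrix. -/
noncomputable def couplingEigenvalue (a₁ a₂ : ℝ) (j : ZMod N) : ℝ :=
  a₁ + 2 * a₂ * (stdAddChar j : ℂ).re

/-- The discrete Fourier transform diagonalises the coupling matrix. -/
theorem sum_stdAddChar_mul_couplingMatrix (a₁ a₂ : ℝ) (x : ZMod N → ℝ) (j : ZMod N) :
    ∑ k, stdAddChar (-(k * j)) * (((couplingMatrix N a₂ a₁ a₂ *ᵥ x) k : ℝ) : ℂ) =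
      couplingEigenvalue a₁ a₂ j * ∑ k, stdAddChar (-(k * j)) * (x k : ℂ) := by
  have h1 : ∑ k, stdAddChar (-(k * j)) * (x (k + 1) : ℂ) =
      stdAddChar j * ∑ k, stdAddChar (-(k * j)) * (x k : ℂ) := by
    rw [Finset.mul_sum]
    refine Fintype.sum_equiv (Equiv.addRight 1) _ _ fun k => ?_
    rw [← mul_assoc, ← AddChar.map_add_eq_mul, Equiv.coe_addRight]
    ring_nf
  have h2 : ∑ k, stdAddChar (-(k * j)) * (x (k - 1) : ℂ) =
      stdAddChar (-j) * ∑ k, stdAddChar (-(k * j)) * (x k : ℂ) := by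
    rw [Finset.mul_sum]
    refine Fintype.sum_equiv (Equiv.subRight 1) _ _ fun k => ?_
    rw [← mul_assoc, ← AddChar.map_add_eq_mul, Equiv.subRight_apply]
    ring_nf
  simp_rw [couplingMatrix_mulVec]
  push_cast
  simp_rw [mul_add, mul_left_comm (stdAddChar _ : ℂ)]
  rw [Finset.sum_add_distrib, Finset.sum_add_distrib, ← Finset.mul_sum, ← Finset.mul_sum,
    ← Finset.mul_sum, h1, h2, couplingEigenvalue]
  push_cast
  linear_combination (a₂ : ℂ) * (∑ k, stdAddChar (-(k * j)) * (x k : ℂ)) *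
    stdAddChar_add_stdAddChar_neg j

theorem couplingMatrix_mulVec_re_stdAddChar (a₁ a₂ : ℝ) (j : ZMod N) :
    couplingMatrix N a₂ a₁ a₂ *ᵥ (fun k => (stdAddChar (j * k) : ℂ).re) =
      couplingEigenvalue a₁ a₂ j • fun k => (stdAddChar (j * k) : ℂ).re := by
  ext k
  rw [couplingMatrix_mulVec, Pi.smul_apply, smul_eq_mul, couplingEigenvalue]
  have h : (stdAddChar (j * (k + 1)) : ℂ) + stdAddChar (j * (k - 1)) =
      ((2 * (stdAddChar j : ℂ).re : ℝ) : ℂ) * stdAddChar (j * k) := by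
    push_cast
    rw [← stdAddChar_add_stdAddChar_neg, mul_add, mul_sub, mul_one, sub_eq_add_neg,
      AddChar.map_add_eq_mul, AddChar.map_add_eq_mul]
    ring
  have h' := congrArg Complex.re h
  rw [Complex.add_re, Complex.re_ofReal_mul] at h'
  linear_combination a₂ * h'

variable {α : ℝ}

/-- Every Fourier coefficient of a solution evolves by a scalar system. -/
theorem IsSolution.sum_stdAddChar_mul {a₁ a₂ : ℝ} {Y : ℕ → ZMod N → ℝ}
    (hY : IsSolution α (couplingMatrix N a₂ a₁ a₂) Y) (j : ZMod N) (t : ℕ) :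
    ∑ k, stdAddChar (-(k * j)) * (Y t k : ℂ) =
      fundamentalSolution α (couplingEigenvalue a₁ a₂ j - 1) t *
        ∑ k, stdAddChar (-(k * j)) * (Y 0 k : ℂ) := by
  refine eq_fundamentalSolution_mul (x := fun t => ∑ k, stdAddChar (-(k * j)) * (Y t k : ℂ))
    (fun t => ?_) t
  have h1 : ∀ i, ∑ k, stdAddChar (-(k * j)) *
      ((((couplingMatrix N a₂ a₁ a₂ - 1) *ᵥ Y i) k : ℝ) : ℂ) =
      (couplingEigenvalue a₁ a₂ j - 1) * ∑ k, stdAddChar (-(k * j)) * (Y i k : ℂ) := by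
    intro i
    simp_rw [Matrix.sub_mulVec, Matrix.one_mulVec, Pi.sub_apply, Complex.ofReal_sub, mul_sub]
    rw [Finset.sum_sub_distrib, sum_stdAddChar_mul_couplingMatrix, sub_mul, one_mul]
  simp_rw [hY t, Pi.add_apply, Finset.sum_apply, Pi.smul_apply, smul_eq_mul]
  push_cast
  simp_rw [mul_add, Finset.sum_add_distrib, Finset.mul_sum]
  congr 1
  rw [Finset.sum_comm]
  refine Finset.sum_congr rfl fun i _ => ?_
  simp_rw [mul_left_comm (stdAddChar _ : ℂ) (kernel α _ : ℂ)]
  rw [← Finset.mul_sum, h1, ← Finset.mul_sum, ← Finset.mul_sum]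
  ring

/-- Fourier inversion for solutions. -/
theorem IsSolution.apply_eq {a₁ a₂ : ℝ} {Y : ℕ → ZMod N → ℝ}
    (hY : IsSolution α (couplingMatrix N a₂ a₁ a₂) Y) (t : ℕ) (k : ZMod N) :
    (Y t k : ℂ) = (N : ℂ)⁻¹ * ∑ j, stdAddChar (j * k) *
      (fundamentalSolution α (couplingEigenvalue a₁ a₂ j - 1) t *
        ∑ m, stdAddChar (-(m * j)) * (Y 0 m : ℂ)) := by
  have h := congrFun (dft.symm_apply_apply (fun k => (Y t k : ℂ))) k
  rw [invDFT_apply] at h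
  simp_rw [dft_apply, smul_eq_mul] at h
  rw [← h]
  congr 1
  exact Finset.sum_congr rfl fun j _ => by rw [hY.sum_stdAddChar_mul]

theorem IsSolution.norm_le {a₁ a₂ : ℝ} {Y : ℕ → ZMod N → ℝ}
    (hY : IsSolution α (couplingMatrix N a₂ a₁ a₂) Y) (t : ℕ) :
    ‖Y t‖ ≤ (∑ j : ZMod N, |fundamentalSolution α (couplingEigenvalue a₁ a₂ j - 1) t|) *
      ‖Y 0‖ := by
  have hN : (0 : ℝ) < N := by exact_mod_cast NeZero.pos N
  have hm : ∀ j : ZMod N, ‖∑ m, stdAddChar (-(m * j)) * (Y 0 m : ℂ)‖ ≤ N * ‖Y 0‖ := by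
    intro j
    refine (norm_sum_le_of_le (f := fun m => stdAddChar (-(m * j)) * (Y 0 m : ℂ))
      (n := fun _ => ‖Y 0‖) _ fun m _ => ?_).trans ?_
    · rw [norm_mul, AddChar.norm_apply, one_mul, Complex.norm_real]
      exact norm_le_pi_norm _ m
    · simp [ZMod.card]
  refine (pi_norm_le_iff_of_nonneg (by positivity)).2 fun k => ?_
  rw [← Complex.norm_real, hY.apply_eq, norm_mul, norm_inv, Complex.norm_natCast,
    inv_mul_le_iff₀ hN, Finset.sum_mul, Finset.mul_sum]
  refine norm_sum_le_of_le _ fun j _ => ?_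
  rw [norm_mul, norm_mul, AddChar.norm_apply, one_mul, Complex.norm_real, mul_left_comm]
  exact mul_le_mul_of_nonneg_left (hm j) (abs_nonneg _)

/-- The real parts of the characters are eigenvectors of the coupling matrix and give solutions that
stay on a line. -/
theorem isSolution_fundamentalSolution (a₁ a₂ r : ℝ) (j : ZMod N) :
    IsSolution α (couplingMatrix N a₂ a₁ a₂) fun t =>
      (r * fundamentalSolution α (couplingEigenvalue a₁ a₂ j - 1) t) •
        fun k => (stdAddChar (j * k) : ℂ).re := by
  intro t
  simp_rw [Matrix.mulVec_smul, Matrix.sub_mulVec, Matrix.one_mulVec,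
    couplingMatrix_mulVec_re_stdAddChar]
  rw [fundamentalSolution_succ, fundamentalSolution_zero]
  ext k
  simp only [Pi.smul_apply, Pi.add_apply, Finset.sum_apply, Pi.sub_apply, smul_eq_mul]
  rw [mul_add, add_mul, Finset.mul_sum, Finset.mul_sum, Finset.sum_mul]
  congr 1
  refine Finset.sum_congr rfl fun i _ => ?_
  ring

/-- Asymptotic stability holds exactly if every eigenvalue lies in `(1 - 2 ^ α, 1)`. -/
theorem zeroAsymptoticallyStable_iff (h0 : 0 < α) (h1 : α < 1) (a₁ a₂ : ℝ) :
    ZeroAsymptoticallyStable α (couplingMatrix N a₂ a₁ a₂) ↔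
      ∀ j : ZMod N, 1 - 2 ^ α < couplingEigenvalue a₁ a₂ j ∧ couplingEigenvalue a₁ a₂ j < 1 := by
  constructor
  · rintro ⟨-, δ, hδ, h⟩ j
    by_contra hj
    have hnot : ¬ Tendsto (fundamentalSolution α (couplingEigenvalue a₁ a₂ j - 1)) atTop (𝓝 0) := by
      rcases not_and_or.1 hj with hj | hj
      · exact not_tendsto_fundamentalSolution h0 h1 (by linarith)
      · intro hu
        have := ge_of_tendsto' hu
          (one_le_fundamentalSolution h0 (by linarith : 0 ≤ couplingEigenvalue a₁ a₂ j - 1))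
        linarith
    refine hnot ?_
    have hX := h _ (isSolution_fundamentalSolution a₁ a₂ (δ / 2) j) ?_
    · have h' := ((tendsto_pi_nhds.1 hX 0).const_mul (2 / δ))
      simp only [Pi.smul_apply, mul_zero, AddChar.map_zero_eq_one, Complex.one_re, smul_eq_mul,
        mul_one, Pi.zero_apply] at h'
      refine h'.congr fun t => ?_
      field_simp
    · rw [fundamentalSolution_zero, mul_one, norm_smul, Real.norm_of_nonneg (by positivity)]
      have : ‖fun k => (stdAddChar (j * k) : ℂ).re‖ ≤ 1 := by
        refine (pi_norm_le_iff_of_nonneg zero_le_one).2 fun k => ?_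
        exact (Complex.abs_re_le_norm _).trans (AddChar.norm_apply _ _).le
      nlinarith
  · intro h
    have hu : ∀ j : ZMod N,
        Tendsto (fundamentalSolution α (couplingEigenvalue a₁ a₂ j - 1)) atTop (𝓝 0) := fun j =>
      tendsto_fundamentalSolution_zero h0 h1 (by linarith [(h j).1]) (by linarith [(h j).2])
    have hS : Tendsto (fun t => ∑ j : ZMod N,
        |fundamentalSolution α (couplingEigenvalue a₁ a₂ j - 1) t|) atTop (𝓝 0) := by
      simpa using tendsto_finsetSum Finset.univ fun j _ => (hu j).abs
    refine ⟨fun ε hε => ?_, 1, one_pos, fun Y hY _ => ?_⟩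
    · obtain ⟨M, hM⟩ := hS.bddAbove_range
      have hM0 : 0 ≤ M := le_trans (Finset.sum_nonneg fun _ _ => abs_nonneg _) (hM ⟨0, rfl⟩)
      refine ⟨ε / (M + 1), by positivity, fun Y hY hY0 t => ?_⟩
      rw [lt_div_iff₀ (by positivity)] at hY0
      have h2 := mul_le_mul_of_nonneg_right (hM ⟨t, rfl⟩) (norm_nonneg (Y 0))
      have h3 := hY.norm_le t
      simp only at h2
      nlinarith [norm_nonneg (Y 0)]
    · refine squeeze_zero_norm hY.norm_le ?_
      simpa using hS.mul_const ‖Y 0‖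

end FracCML

/-! ### The region in the parameter plane -/

namespace FracCML

open Set ZMod

/-- `(a₂, a₁) ↦ (a₁ + 2 a₂, a₁ - 2 c a₂)`. It sends a point of the parameter plane to the two
extreme eigenvalues of the coupling matrix, where `-c` is the least of the values
`cos (2πj/N)`. -/
noncomputable def extremeEigenvalues (c : ℝ) (hc : 0 < 1 + c) : (ℝ × ℝ) ≃L[ℝ] (ℝ × ℝ) :=
  LinearEquiv.toContinuousLinearEquiv
    { toFun := fun p => (p.2 + 2 * p.1, p.2 - 2 * c * p.1)
      invFun := fun q => ((q.1 - q.2) / (2 * (1 + c)), (c * q.1 + q.2) / (1 + c))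
      map_add' := fun p q => by ext <;> simp only [Prod.fst_add, Prod.snd_add] <;> ring
      map_smul' := fun r p => by ext <;> (simp; ring)
      left_inv := fun p => by
        ext <;> simp <;> field_simp
        ring
      right_inv := fun p => by ext <;> simp <;> field_simp <;> ring }

theorem extremeEigenvalues_apply (c : ℝ) (hc : 0 < 1 + c) (p : ℝ × ℝ) :
    extremeEigenvalues c hc p = (p.2 + 2 * p.1, p.2 - 2 * c * p.1) := rfl

theorem interior_convexHull_square {a b : ℝ} (h : a < b) :
    interior (convexHull ℝ {((b, b) : ℝ × ℝ), (a, b), (a, a), (b, a)}) = Ioo a b ×ˢ Ioo a b := by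
  have hs : ({((b, b) : ℝ × ℝ), (a, b), (a, a), (b, a)} : Set (ℝ × ℝ)) = {a, b} ×ˢ {a, b} := by
    ext ⟨x, y⟩
    simp only [mem_insert_iff, mem_singleton_iff, Prod.mk.injEq, mem_prod]
    tauto
  rw [hs, convexHull_prod, convexHull_pair, segment_eq_Icc h.le, interior_prod_eq, interior_Icc]

theorem frontier_square {a b : ℝ} (h : a < b) :
    frontier (Ioo a b ×ˢ Ioo a b) = segment ℝ ((b, b) : ℝ × ℝ) (a, b) ∪
      segment ℝ (a, b) (a, a) ∪ segment ℝ (a, a) (b, a) ∪ segment ℝ (b, a) (b, b) := by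
  rw [frontier_prod_eq, closure_Ioo h.ne, frontier_Ioo h, ← Prod.image_mk_segment_left,
    ← Prod.image_mk_segment_left, ← Prod.image_mk_segment_right, ← Prod.image_mk_segment_right,
    segment_symm ℝ b a, segment_eq_Icc h.le]
  ext ⟨x, y⟩
  simp only [mem_union, mem_prod, mem_image, mem_insert_iff, mem_singleton_iff, Prod.mk.injEq]
  aesop

/-- The region is the preimage of an open square under a linear isomorphism, and such a map commutes
with convex hulls, interiors, frontiers and segments. -/
theorem isRegionBoundedByQuadrilateral_of_extremeEigenvalues {c a b : ℝ} (hc : 0 < 1 + c)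
    (h : a < b) {S : Set (ℝ × ℝ)} {P₁ P₂ P₃ P₄ : ℝ × ℝ}
    (hS : S = extremeEigenvalues c hc ⁻¹' (Ioo a b ×ˢ Ioo a b))
    (h₁ : extremeEigenvalues c hc P₁ = (b, b)) (h₂ : extremeEigenvalues c hc P₂ = (a, b))
    (h₃ : extremeEigenvalues c hc P₃ = (a, a)) (h₄ : extremeEigenvalues c hc P₄ = (b, a)) :
    IsRegionBoundedByQuadrilateral S P₁ P₂ P₃ P₄ := by
  set e := extremeEigenvalues c hc
  have hinj : Function.Injective (fun s : Set (ℝ × ℝ) => e '' s) := e.injective.image_injective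
  have hS' : e '' S = Ioo a b ×ˢ Ioo a b := by
    rw [hS, image_preimage_eq _ e.surjective]
  have hseg : ∀ x y, e '' segment ℝ x y = segment ℝ (e x) (e y) := fun x y =>
    image_segment ℝ (e : (ℝ × ℝ) →ₗ[ℝ] (ℝ × ℝ)).toAffineMap x y
  constructor
  · refine hinj ?_
    have h1 := e.toHomeomorph.image_interior (convexHull ℝ {P₁, P₂, P₃, P₄})
    have h2 := (e : (ℝ × ℝ) →ₗ[ℝ] (ℝ × ℝ)).image_convexHull {P₁, P₂, P₃, P₄}
    change e '' _ = interior (e '' _) at h1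
    change e '' _ = convexHull ℝ (e '' _) at h2
    change e '' S = e '' _
    rw [h1, h2, hS', image_insert_eq, image_insert_eq, image_insert_eq, image_singleton,
      h₁, h₂, h₃, h₄, interior_convexHull_square h]
  · refine hinj ?_
    have h1 := e.toHomeomorph.image_frontier S
    change e '' _ = frontier (e '' _) at h1
    change e '' _ = e '' _
    rw [h1, hS', image_union, image_union, image_union, hseg, hseg, hseg, hseg, h₁, h₂, h₃, h₄,
      frontier_square h]

variable {N : ℕ} [NeZero N]

theorem re_stdAddChar_natCast (n : ℕ) :
    (stdAddChar (n : ZMod N) : ℂ).re = Real.cos (2 * Real.pi * n / N) := by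
  have h := stdAddChar_coe (N := N) n
  rw [Int.cast_natCast] at h
  rw [h, ← Complex.exp_ofReal_mul_I_re]
  congr 2
  push_cast
  ring

theorem re_stdAddChar_le_one (j : ZMod N) : (stdAddChar j : ℂ).re ≤ 1 :=
  (Complex.re_le_norm _).trans (AddChar.norm_apply _ _).le

theorem neg_one_le_re_stdAddChar (j : ZMod N) : -1 ≤ (stdAddChar j : ℂ).re :=
  (abs_le.1 ((Complex.abs_re_le_norm _).trans (AddChar.norm_apply _ _).le)).1

theorem exists_re_stdAddChar_eq_neg_one (hN : Even N) :
    ∃ j : ZMod N, (stdAddChar j : ℂ).re = -1 := by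
  obtain ⟨m, hm⟩ := hN
  have hN0 : (N : ℝ) ≠ 0 := by exact_mod_cast NeZero.ne N
  refine ⟨(m : ℕ), ?_⟩
  rw [re_stdAddChar_natCast, show 2 * Real.pi * m / N = Real.pi by
    rw [div_eq_iff hN0, hm]; push_cast; ring, Real.cos_pi]

theorem exists_re_stdAddChar_eq_neg_cos (hN : Odd N) :
    ∃ j : ZMod N, (stdAddChar j : ℂ).re = -Real.cos (Real.pi / N) := by
  obtain ⟨m, hm⟩ := hN
  have hN0 : (N : ℝ) ≠ 0 := by exact_mod_cast NeZero.ne N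
  refine ⟨(m : ℕ), ?_⟩
  rw [re_stdAddChar_natCast, ← Real.cos_pi_sub]
  congr 1
  have : (N : ℝ) = 2 * m + 1 := by exact_mod_cast hm
  field_simp
  rw [this]
  ring

/-- For odd `N` no angle `2πj/N` is closer to `π` than `π/N`, as `2j - N` is odd. -/
theorem neg_cos_le_re_stdAddChar (hN : Odd N) (j : ZMod N) :
    -Real.cos (Real.pi / N) ≤ (stdAddChar j : ℂ).re := by
  have hN0 : (0 : ℝ) < N := by exact_mod_cast NeZero.pos N
  have hj := re_stdAddChar_natCast (N := N) j.val
  rw [ZMod.natCast_zmod_val] at hj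
  have hπ := Real.pi_pos
  have hlt : (j.val : ℝ) ≤ N := by exact_mod_cast (ZMod.val_lt j).le
  have habs : (1 : ℝ) ≤ |(N : ℝ) - 2 * j.val| := by
    have h : (1 : ℤ) ≤ |(N : ℤ) - 2 * j.val| := by
      obtain ⟨m, hm⟩ := hN
      refine Int.one_le_abs ?_
      omega
    exact_mod_cast h
  have hφ : |Real.pi - 2 * Real.pi * j.val / N| = Real.pi / N * |(N : ℝ) - 2 * j.val| := by
    rw [← abs_of_pos (div_pos hπ hN0), ← abs_mul]
    congr 1
    field_simp
  have hcos := Real.cos_le_cos_of_nonneg_of_le_pi (x := Real.pi / N)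
    (y := |Real.pi - 2 * Real.pi * j.val / N|) (by positivity) ?_ ?_
  · rw [Real.cos_abs, Real.cos_pi_sub] at hcos
    rw [hj]
    linarith
  · rw [hφ, div_mul_eq_mul_div, div_le_iff₀ hN0]
    refine mul_le_mul_of_nonneg_left (abs_le.2 ⟨?_, ?_⟩) hπ.le
    · linarith
    · linarith [(Nat.cast_nonneg j.val : (0 : ℝ) ≤ j.val)]
  · rw [hφ]
    exact le_mul_of_one_le_right (by positivity) habs

/-- The stable region, when the values `cos (2πj/N)` range over a subset of `[-c, 1]` containing
both end points. -/
theorem symmetricStableRegion_eq {α : ℝ} (h0 : 0 < α) (h1 : α < 1) {c : ℝ} (hc : 0 < 1 + c)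
    (hle : ∀ j : ZMod N, -c ≤ (stdAddChar j : ℂ).re)
    (hex : ∃ j : ZMod N, (stdAddChar j : ℂ).re = -c) :
    symmetricStableRegion α N = extremeEigenvalues c hc ⁻¹'
      (Ioo (1 - 2 ^ α) 1 ×ˢ Ioo (1 - 2 ^ α) 1) := by
  ext ⟨x, y⟩
  rw [symmetricStableRegion, mem_ofPred_eq, zeroAsymptoticallyStable_iff h0 h1, mem_preimage,
    extremeEigenvalues_apply]
  simp only [mem_prod, mem_Ioo, couplingEigenvalue]
  constructor
  · intro h
    obtain ⟨j, hj⟩ := hex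
    have hz := h 0
    have hj' := h j
    rw [AddChar.map_zero_eq_one, Complex.one_re] at hz
    rw [hj] at hj'
    refine ⟨⟨?_, ?_⟩, ?_, ?_⟩ <;> linarith [hz.1, hz.2, hj'.1, hj'.2]
  · rintro ⟨⟨ha, hb⟩, ha', hb'⟩ j
    have hl := hle j
    have hu := re_stdAddChar_le_one j
    -- an affine function of `cos (2πj/N)` lies between its values at the end points
    rcases le_total 0 x with hx | hx
    · constructor <;> nlinarith
    · constructor <;> nlinarith

end FracCML

theorem mainTheorem1 (α : ℝ) (hα0 : 0 < α) (hα1 : α < 1) (N : ℕ) [NeZero N] (hN : 2 ≤ N) :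
    (Even N →
      FracCML.IsRegionBoundedByQuadrilateral (FracCML.symmetricStableRegion α N)
        (0, 1)
        (-(2 : ℝ) ^ (α - 2), (2 : ℝ) ^ (α - 1) + 1 - (2 : ℝ) ^ α)
        (0, 1 - (2 : ℝ) ^ α)
        ((2 : ℝ) ^ (α - 2), 1 - (2 : ℝ) ^ (α - 1))) ∧
    (Odd N →
      FracCML.IsRegionBoundedByQuadrilateral (FracCML.symmetricStableRegion α N)
        (0, 1)
        (-((2 : ℝ) ^ (α - 1) / (1 + Real.cos (Real.pi / N))),
          (2 : ℝ) ^ α / (1 + Real.cos (Real.pi / N)) + 1 - (2 : ℝ) ^ α)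
        (0, 1 - (2 : ℝ) ^ α)
        ((2 : ℝ) ^ (α - 1) / (1 + Real.cos (Real.pi / N)),
          -((2 : ℝ) ^ α / (1 + Real.cos (Real.pi / N))) + 1)) := by
  have hp : (0 : ℝ) < 2 ^ α := by positivity
  have e1 : (2 : ℝ) ^ (α - 1) = 2 ^ α / 2 := by rw [Real.rpow_sub_one two_ne_zero]
  have e2 : (2 : ℝ) ^ (α - 2) = 2 ^ α / 4 := by
    rw [Real.rpow_sub two_pos, Real.rpow_two]
    norm_num
  constructor
  · intro hE
    refine FracCML.isRegionBoundedByQuadrilateral_of_extremeEigenvalues (c := 1) (by norm_num)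
      (by linarith) (FracCML.symmetricStableRegion_eq hα0 hα1 (by norm_num)
        FracCML.neg_one_le_re_stdAddChar (FracCML.exists_re_stdAddChar_eq_neg_one hE)) ?_ ?_ ?_ ?_
    all_goals
      simp only [FracCML.extremeEigenvalues_apply, Prod.mk.injEq, e1, e2]
      constructor <;> ring
  · intro hO
    have hc : 0 < 1 + Real.cos (Real.pi / N) := by
      have hN2 : (2 : ℝ) ≤ N := by exact_mod_cast hN
      have : 0 ≤ Real.cos (Real.pi / N) := Real.cos_nonneg_of_neg_pi_div_two_le_of_le
        (by have := Real.pi_pos; have : 0 ≤ Real.pi / N := by positivity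
            linarith) (div_le_div_of_nonneg_left Real.pi_pos.le two_pos hN2)
      linarith
    refine FracCML.isRegionBoundedByQuadrilateral_of_extremeEigenvalues hc
      (by linarith) (FracCML.symmetricStableRegion_eq hα0 hα1 hc
        (FracCML.neg_cos_le_re_stdAddChar hO) (FracCML.exists_re_stdAddChar_eq_neg_cos hO))
      ?_ ?_ ?_ ?_
    all_goals
      simp only [FracCML.extremeEigenvalues_apply, Prod.mk.injEq, e1]
      constructor <;> field_simp <;> ring
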